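/- Let $A\in\mathbb C^{m\times n}$, $B\in\mathbb C^{m\times p}$, $C\in\mathbb C^{q\times n}$, write $r(\cdot)$ for the rank of a matrix, and put $$G=[\,A,\ B\,],\qquad H=\begin{bmatrix}A\\ C\end{bmatrix},\qquad M=\begin{bmatrix}A&B\\ C&0\end{bmatrix}.$$ Let $s,t$ be integers with $0\le s\le t\le\min\{p,q\}$. Then, over all $X\in\mathbb C^{p\times q}$ with $s\le r(X)\le t$, the rank of $A+BXC$ attains a maximum and a minimum, and $$\max_{X\in\mathbb C^{p\times q},\ s\le r(X)\le t} r(A+BXC)=\min\{\,r(G),\ r(H),\ r(A)+t\,\},$$ $$\min_{X\in\mathbb C^{p\times q},\ s\le r(X)\le t} r(A+BXC)=\min\{u_s,u_{s+1},\dots,u_t\},$$ where, for $l=s,s+1,\dots,t$, $$u_l=\max\{\,r(G)+r(H)-r(M),\ \ r(G)+r(H)-r(A)+l-p-q,\ \ r(A)-l\,\}.$$ -/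

import Mathlib

/-- The function `φ(X) = A + B X C`. -/
def linearMatrixFun {m n p q : ℕ} (A : Matrix (Fin m) (Fin n) ℂ) (B : Matrix (Fin m) (Fin p) ℂ)
    (C : Matrix (Fin q) (Fin n) ℂ) (X : Matrix (Fin p) (Fin q) ℂ) : Matrix (Fin m) (Fin n) ℂ :=
  A + B * X * C

/-- The number `u_l`, an integer-valued maximum; here `G = [A, B]` is `Matrix.fromCols A B`, `H` is
`A` on top of `C`, and `M` is the block matrix with rows `[A, B]` and `[C, 0]`. -/
noncomputable def uRank {m n p q : ℕ} (A : Matrix (Fin m) (Fin n) ℂ) (B : Matrix (Fin m) (Fin p) ℂ)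
    (C : Matrix (Fin q) (Fin n) ℂ) (l : ℕ) : ℤ :=
  max (((Matrix.fromCols A B).rank : ℤ) + ((Matrix.fromRows A C).rank : ℤ)
        - ((Matrix.fromBlocks A B C 0).rank : ℤ))
    (max (((Matrix.fromCols A B).rank : ℤ) + ((Matrix.fromRows A C).rank : ℤ) - (A.rank : ℤ)
        + (l : ℤ) - (p : ℤ) - (q : ℤ))
      ((A.rank : ℤ) - (l : ℤ)))

/-- The ranks of `φ(X)`, as integers, over all `X` with `s ≤ rank X ≤ t`. -/
def feasibleRanks {m n p q : ℕ} (A : Matrix (Fin m) (Fin n) ℂ) (B : Matrix (Fin m) (Fin p) ℂ)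
    (C : Matrix (Fin q) (Fin n) ℂ) (s t : ℕ) : Set ℤ :=
  {k | ∃ X : Matrix (Fin p) (Fin q) ℂ, s ≤ X.rank ∧ X.rank ≤ t ∧
    k = ((linearMatrixFun A B C X).rank : ℤ)}

set_option linter.unusedSectionVars false

/-! Write T = A + BXC for linear maps X. The subspaces range T + range B, ker T ∩ ker C and the
kernel of the block map do not depend on X, so replacing A by T leaves r(G), r(H) and r(M)
unchanged. Hence r(T) ≤ r(G) and r(T) ≤ r(H), and the inequality r(G) + r(H) - r(M) ≤ r(A) holds for
T as well. Subadditivity gives the bounds r(A) ± r(X). The remaining lower bound holds because X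
sends C(ker T) into B⁻¹(range A).

Sharpness is proved by building X from rank one summands. For the maximum, each summand raises r(X)
and r(T) together until r(T) reaches r(G) or r(H); afterwards a suitable scaling keeps r(T) from
dropping (`exists_finrank_range_affineMap_max`).

For the minimum at r(X) = l, summands lower r(T) by one each (`IsReducing.exists_succ`). If this
lasts l steps, r(A) - l is attained. Otherwise it stops at some d ≤ l with r(T) = r(G) + r(H) -
r(M). Put U = B⁻¹(range T) and K = C(ker T) for this T. Further summands with values in U or
vanishing on K do not raise the rank (`finrank_range_affineMap_add_le`). Such summands run out only
when dimensions force it, and every extra one costs at most one (`exists_isExtension`); the total is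
then the third bound. -/

namespace RankUpdate

open Module LinearMap

/-! ### Rank one updates of a linear map -/

section Basic

variable {𝕜 E F : Type*} [Field 𝕜] [AddCommGroup E] [Module 𝕜 E] [FiniteDimensional 𝕜 E]
  [AddCommGroup F] [Module 𝕜 F] [FiniteDimensional 𝕜 F]

theorem finrank_range_add_le (S T : E →ₗ[𝕜] F) :
    finrank 𝕜 (range (S + T)) ≤ finrank 𝕜 (range S) + finrank 𝕜 (range T) :=
  (Submodule.finrank_mono (LinearMap.range_add_le S T)).trans
    (Submodule.finrank_add_le_finrank_add_finrank _ _)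

theorem finrank_range_smulRight_le (v : E →ₗ[𝕜] 𝕜) (u : F) :
    finrank 𝕜 (range (v.smulRight u)) ≤ 1 := by
  have h : range (v.smulRight u) ≤ Submodule.span 𝕜 {u} := by
    rintro _ ⟨z, rfl⟩
    exact Submodule.smul_mem _ _ (Submodule.mem_span_singleton_self u)
  exact (Submodule.finrank_mono h).trans ((finrank_span_le_card {u}).trans (by simp))

theorem finrank_range_le_of_ker_le {S T : E →ₗ[𝕜] F} (h : ker S ≤ ker T) :
    finrank 𝕜 (range T) ≤ finrank 𝕜 (range S) := by
  have h1 := finrank_range_add_finrank_ker S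
  have h2 := finrank_range_add_finrank_ker T
  have h3 := Submodule.finrank_mono h
  omega

theorem finrank_range_lt_of_ker_lt {S T : E →ₗ[𝕜] F} (h : ker S < ker T) :
    finrank 𝕜 (range T) < finrank 𝕜 (range S) := by
  have h1 := finrank_range_add_finrank_ker S
  have h2 := finrank_range_add_finrank_ker T
  have h3 := Submodule.finrank_lt_finrank_of_lt h
  omega

theorem range_le_range_add_smulRight {T : E →ₗ[𝕜] F} {v : E →ₗ[𝕜] 𝕜} {u : F} {z : E}
    (hz : T z = 0) (hv : v z ≠ 0) :
    range T ≤ range (T + v.smulRight u) ∧ u ∈ range (T + v.smulRight u) := by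
  have hu : u ∈ range (T + v.smulRight u) :=
    ⟨(v z)⁻¹ • z, by simp [hz, hv]⟩
  refine ⟨?_, hu⟩
  rintro _ ⟨x, rfl⟩
  have : T x = (T + v.smulRight u) x - v x • u := by simp
  rw [this]
  exact sub_mem ⟨x, rfl⟩ (Submodule.smul_mem _ _ hu)

theorem ker_add_smulRight_le {T : E →ₗ[𝕜] F} {v : E →ₗ[𝕜] 𝕜} {u : F} (hu : u ∉ range T) :
    ker (T + v.smulRight u) ≤ ker T := by
  intro x hx
  have hx' : T x + v x • u = 0 := by simpa using hx
  by_cases hv : v x = 0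
  · simpa [hv] using hx'
  · refine absurd ⟨-(v x)⁻¹ • x, ?_⟩ hu
    rw [map_smul, eq_neg_of_add_eq_zero_left hx', smul_neg, neg_smul, neg_neg, smul_smul,
      inv_mul_cancel₀ hv, one_smul]

theorem finrank_range_add_smulRight_le (T : E →ₗ[𝕜] F) (v : E →ₗ[𝕜] 𝕜) (u : F) :
    finrank 𝕜 (range (T + v.smulRight u)) ≤ finrank 𝕜 (range T) + 1 :=
  (finrank_range_add_le _ _).trans (Nat.add_le_add_left (finrank_range_smulRight_le v u) _)

theorem finrank_range_le_add_smulRight (T : E →ₗ[𝕜] F) (v : E →ₗ[𝕜] 𝕜) (u : F) :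
    finrank 𝕜 (range T) ≤ finrank 𝕜 (range (T + v.smulRight u)) + 1 := by
  have h := finrank_range_add_smulRight_le (T + v.smulRight u) (-v) u
  have h' : T + v.smulRight u + (-v).smulRight u = T := by
    ext x; simp
  rwa [h'] at h

theorem finrank_range_add_smulRight {T : E →ₗ[𝕜] F} {v : E →ₗ[𝕜] 𝕜} {u : F} {z : E}
    (hz : T z = 0) (hv : v z ≠ 0) (hu : u ∉ range T) :
    finrank 𝕜 (range (T + v.smulRight u)) = finrank 𝕜 (range T) + 1 := by
  refine le_antisymm (finrank_range_add_smulRight_le T v u) ?_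
  obtain ⟨h1, h2⟩ := range_le_range_add_smulRight (u := u) hz hv
  exact Submodule.finrank_lt_finrank_of_lt (lt_of_le_of_ne h1 fun h => hu (h ▸ h2))

theorem range_add_smulRight_le {T : E →ₗ[𝕜] F} {v : E →ₗ[𝕜] 𝕜} {u : F} (hu : u ∈ range T) :
    range (T + v.smulRight u) ≤ range T := by
  rintro _ ⟨x, rfl⟩
  exact add_mem ⟨x, rfl⟩ (Submodule.smul_mem _ _ hu)

/-- Adding some nonzero multiple of a given rank one map does not lower the rank. -/
theorem exists_smul_finrank_range_le [CharZero 𝕜] (T : E →ₗ[𝕜] F) (v : E →ₗ[𝕜] 𝕜) (u : F) :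
    ∃ c : 𝕜, c ≠ 0 ∧ finrank 𝕜 (range T) ≤ finrank 𝕜 (range (T + v.smulRight (c • u))) := by
  by_cases hk : ker T ≤ ker v
  · by_contra! hc
    have key : ∀ c : 𝕜, c ≠ 0 → ∃ y, v y = 1 ∧ T y = -(c • u) := by
      intro c hc0
      by_contra! hy
      refine (hc c hc0).not_ge (finrank_range_le_of_ker_le fun x hx => ?_)
      have hx' : T x + v x • (c • u) = 0 := by simpa using hx
      by_cases hv : v x = 0
      · simpa [hv] using hx'
      · refine absurd ?_ (hy ((v x)⁻¹ • x) (by simp [hv]))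
        rw [map_smul, eq_neg_of_add_eq_zero_left hx', smul_neg, smul_smul, inv_mul_cancel₀ hv,
          one_smul]
    -- A rank drop at both c = 1 and c = 2 gives y and z with 2y - z in ker T but v(2y - z) = 1,
    -- against ker T ≤ ker v.
    obtain ⟨y, hy, hTy⟩ := key 1 one_ne_zero
    obtain ⟨z, hz, hTz⟩ := key 2 two_ne_zero
    have h0 : (2 : 𝕜) • y - z ∈ ker T := by
      simp [hTy, hTz]
    have h1 : v ((2 : 𝕜) • y - z) = 0 := hk h0
    rw [map_sub, map_smul, hy, hz] at h1
    norm_num at h1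
  · obtain ⟨z, hz, hv⟩ := Set.not_subset.mp hk
    exact ⟨1, one_ne_zero, Submodule.finrank_mono (range_le_range_add_smulRight hz hv).1⟩

theorem exists_notMem_notMem {S T : Submodule 𝕜 E} (hS : S ≠ ⊤) (hT : T ≠ ⊤) :
    ∃ x, x ∉ S ∧ x ∉ T := by
  obtain ⟨x, hx⟩ : ∃ x, x ∉ S := by
    by_contra! h; exact hS (Submodule.eq_top_iff'.mpr h)
  obtain ⟨y, hy⟩ : ∃ y, y ∉ T := by
    by_contra! h; exact hT (Submodule.eq_top_iff'.mpr h)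
  by_cases hxT : x ∈ T
  · by_cases hyS : y ∈ S
    · exact ⟨x + y, fun h => hx ((S.add_mem_iff_left hyS).mp h),
        fun h => hy ((T.add_mem_iff_right hxT).mp h)⟩
    · exact ⟨y, hyS, hy⟩
  · exact ⟨x, hx, hxT⟩

theorem exists_dual_ne_zero {x : E} (hx : x ≠ 0) : ∃ v : E →ₗ[𝕜] 𝕜, v x ≠ 0 := by
  by_contra! h
  exact hx ((Module.forall_dual_apply_eq_zero_iff 𝕜 x).mp h)

theorem exists_dual_ne_zero_ne_zero {x y : E} (hx : x ≠ 0) (hy : y ≠ 0) :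
    ∃ v : E →ₗ[𝕜] 𝕜, v x ≠ 0 ∧ v y ≠ 0 := by
  have h : ∀ {z : E}, z ≠ 0 → ker (Module.Dual.eval 𝕜 E z) ≠ ⊤ := by
    intro z hz h
    obtain ⟨v, hv⟩ := exists_dual_ne_zero (𝕜 := 𝕜) hz
    exact hv (by simpa using (h ▸ Submodule.mem_top : v ∈ ker (Module.Dual.eval 𝕜 E z)))
  obtain ⟨v, h1, h2⟩ := exists_notMem_notMem (h hx) (h hy)
  exact ⟨v, by simpa using h1, by simpa using h2⟩

theorem exists_notMem_of_finrank_range_lt {X : E →ₗ[𝕜] F}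
    (h : finrank 𝕜 (range X) < finrank 𝕜 F) : range X ≠ ⊤ := by
  intro h'
  rw [h', finrank_top] at h
  exact lt_irrefl _ h

theorem exists_ker_ne_zero_of_finrank_range_lt {X : E →ₗ[𝕜] F}
    (h : finrank 𝕜 (range X) < finrank 𝕜 E) : ∃ z, X z = 0 ∧ z ≠ 0 := by
  have h1 := finrank_range_add_finrank_ker X
  have h2 : ker X ≠ ⊥ := by
    intro h'
    rw [h', finrank_bot] at h1
    omega
  obtain ⟨z, hz, h0⟩ := Submodule.exists_mem_ne_zero_of_ne_bot h2
  exact ⟨z, hz, h0⟩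

end Basic

/-! ### The family A + BXC: invariants, upper bounds and the maximum -/

section Triple

variable {𝕜 N M P Q : Type*} [Field 𝕜] [AddCommGroup N] [Module 𝕜 N] [FiniteDimensional 𝕜 N]
  [AddCommGroup M] [Module 𝕜 M] [FiniteDimensional 𝕜 M]
  [AddCommGroup P] [Module 𝕜 P] [FiniteDimensional 𝕜 P]
  [AddCommGroup Q] [Module 𝕜 Q] [FiniteDimensional 𝕜 Q]
  (A : N →ₗ[𝕜] M) (B : P →ₗ[𝕜] M) (C : N →ₗ[𝕜] Q)

/-- The affine map `X ↦ A + B X C` on linear maps. -/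
abbrev affineMap (X : Q →ₗ[𝕜] P) : N →ₗ[𝕜] M := A + B ∘ₗ X ∘ₗ C

theorem affineMap_zero : affineMap A B C 0 = A := by
  ext y; simp

theorem affineMap_add_smulRight (X : Q →ₗ[𝕜] P) (v : Q →ₗ[𝕜] 𝕜) (u : P) :
    affineMap A B C (X + v.smulRight u) =
      affineMap A B C X + (v ∘ₗ C).smulRight (B u) := by
  ext y; simp [add_assoc]

theorem range_affineMap_sup (X : Q →ₗ[𝕜] P) :
    range (affineMap A B C X) ⊔ range B = range A ⊔ range B := by
  apply le_antisymm
  · refine sup_le ?_ le_sup_right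
    rintro _ ⟨y, rfl⟩
    exact Submodule.add_mem_sup ⟨y, rfl⟩ ⟨_, rfl⟩
  · refine sup_le ?_ le_sup_right
    rintro _ ⟨y, rfl⟩
    have : A y = affineMap A B C X y + B (-(X (C y))) := by simp
    rw [this]
    exact Submodule.add_mem_sup ⟨y, rfl⟩ ⟨_, rfl⟩

theorem ker_affineMap_inf (X : Q →ₗ[𝕜] P) :
    ker (affineMap A B C X) ⊓ ker C = ker A ⊓ ker C := by
  ext y
  simp only [Submodule.mem_inf, mem_ker]
  constructor <;> rintro ⟨h1, h2⟩ <;> simp_all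

theorem finrank_range_affineMap_le_sup (X : Q →ₗ[𝕜] P) :
    finrank 𝕜 (range (affineMap A B C X)) ≤ finrank 𝕜 ↥(range A ⊔ range B) := by
  rw [← range_affineMap_sup A B C X]
  exact Submodule.finrank_mono le_sup_left

theorem finrank_range_affineMap_add_ker_inf_le (X : Q →ₗ[𝕜] P) :
    finrank 𝕜 (range (affineMap A B C X)) + finrank 𝕜 ↥(ker A ⊓ ker C) ≤ finrank 𝕜 N := by
  rw [← ker_affineMap_inf A B C X, ← finrank_range_add_finrank_ker (affineMap A B C X)]
  exact Nat.add_le_add_left (Submodule.finrank_mono inf_le_left) _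

theorem finrank_range_comp_comp_le (X : Q →ₗ[𝕜] P) :
    finrank 𝕜 (range (B ∘ₗ X ∘ₗ C)) ≤ finrank 𝕜 (range X) := by
  have h : range (B ∘ₗ X ∘ₗ C) ≤ (range X).map B := by
    rintro _ ⟨y, rfl⟩
    exact ⟨X (C y), ⟨_, rfl⟩, rfl⟩
  exact (Submodule.finrank_mono h).trans (Submodule.finrank_map_le _ _)

theorem finrank_range_affineMap_le_add (X : Q →ₗ[𝕜] P) :
    finrank 𝕜 (range (affineMap A B C X)) ≤ finrank 𝕜 (range A) + finrank 𝕜 (range X) :=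
  (finrank_range_add_le _ _).trans
    (Nat.add_le_add_left (finrank_range_comp_comp_le B C X) _)

theorem finrank_range_le_affineMap_add (X : Q →ₗ[𝕜] P) :
    finrank 𝕜 (range A) ≤ finrank 𝕜 (range (affineMap A B C X)) + finrank 𝕜 (range X) := by
  have h := finrank_range_affineMap_le_add (affineMap A B C X) B C (-X)
  have h' : affineMap (affineMap A B C X) B C (-X) = A := by ext y; simp
  rwa [h', LinearMap.range_neg] at h

/-- A map of any admissible rank `t` for which the rank of `A + B X C` is as large as possible. -/
theorem exists_finrank_range_affineMap_max [CharZero 𝕜] (t : ℕ) (hP : t ≤ finrank 𝕜 P)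
    (hQ : t ≤ finrank 𝕜 Q) :
    ∃ X : Q →ₗ[𝕜] P, finrank 𝕜 (range X) = t ∧
      (finrank 𝕜 ↥(range A ⊔ range B) ≤ finrank 𝕜 (range (affineMap A B C X)) ∨
      finrank 𝕜 N ≤ finrank 𝕜 (range (affineMap A B C X)) + finrank 𝕜 ↥(ker A ⊓ ker C) ∨
      finrank 𝕜 (range A) + t ≤ finrank 𝕜 (range (affineMap A B C X))) := by
  induction t with
  | zero => exact ⟨0, by simp, Or.inr (Or.inr (by rw [affineMap_zero, add_zero]))⟩
  | succ t ih =>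
    obtain ⟨X, hX, h⟩ := ih (by omega) (by omega)
    have hr : range X ≠ ⊤ := exists_notMem_of_finrank_range_lt (by omega)
    obtain ⟨z, hz, hz0⟩ := exists_ker_ne_zero_of_finrank_range_lt (X := X) (by omega)
    set T := affineMap A B C X with hT
    by_cases h1 : finrank 𝕜 ↥(range A ⊔ range B) ≤ finrank 𝕜 (range T) ∨
        finrank 𝕜 N ≤ finrank 𝕜 (range T) + finrank 𝕜 ↥(ker A ⊓ ker C)
    -- One of the two absolute bounds is already reached: only r(X) has to grow, and scaling u
    -- prevents a loss in r(T).
    · obtain ⟨u, hu, -⟩ := exists_notMem_notMem hr hr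
      obtain ⟨v, hv⟩ := exists_dual_ne_zero (𝕜 := 𝕜) hz0
      obtain ⟨c, hc, hle⟩ := exists_smul_finrank_range_le T (v ∘ₗ C) (B u)
      have hcu : c • u ∉ range X := fun h' => hu (((range X).smul_mem_iff hc).mp h')
      refine ⟨X + v.smulRight (c • u), ?_, ?_⟩
      · rw [finrank_range_add_smulRight hz hv hcu, hX]
      · rw [affineMap_add_smulRight, map_smul, ← hT]
        omega
    -- Neither absolute bound is reached, so range B is not inside range T and ker T is not inside
    -- ker C. This leaves room for u and v that raise both ranks at once.
    · have hB : (range T).comap B ≠ ⊤ := by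
        intro h'
        have : range B ≤ range T := by
          rintro _ ⟨w, rfl⟩
          exact (h' ▸ Submodule.mem_top : w ∈ (range T).comap B)
        have h2 := range_affineMap_sup A B C X
        rw [← hT, sup_eq_left.mpr this] at h2
        rw [← h2] at h1
        exact h1 (Or.inl le_rfl)
      obtain ⟨y, hy, hCy⟩ : ∃ y, T y = 0 ∧ C y ≠ 0 := by
        by_contra! h'
        have : ker T ≤ ker C := fun y hy => h' y hy
        have h2 := ker_affineMap_inf A B C X
        rw [← hT, inf_eq_left.mpr this] at h2
        rw [← h2, finrank_range_add_finrank_ker T] at h1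
        exact h1 (Or.inr le_rfl)
      obtain ⟨u, hu, hBu⟩ := exists_notMem_notMem hr hB
      obtain ⟨v, hv, hvC⟩ := exists_dual_ne_zero_ne_zero (𝕜 := 𝕜) hz0 hCy
      refine ⟨X + v.smulRight u, ?_, Or.inr (Or.inr ?_)⟩
      · rw [finrank_range_add_smulRight hz hv hu, hX]
      · rw [affineMap_add_smulRight, ← hT,
          finrank_range_add_smulRight (v := v ∘ₗ C) hy hvC hBu]
        omega

end Triple

/-! ### Extending a map to a prescribed rank by cheap summands -/

section Extension

variable {𝕜 P Q : Type*} [Field 𝕜] [AddCommGroup P] [Module 𝕜 P] [FiniteDimensional 𝕜 P]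
  [AddCommGroup Q] [Module 𝕜 Q] [FiniteDimensional 𝕜 Q]

theorem finrank_range_add_smulRight_inf_le {U : Submodule 𝕜 P} {X : Q →ₗ[𝕜] P}
    {u : P} (v : Q →ₗ[𝕜] 𝕜) (hu : u ∈ U) :
    finrank 𝕜 ↥(range (X + v.smulRight u) ⊓ U) ≤ finrank 𝕜 ↥(range X ⊓ U) + 1 := by
  have h : range (X + v.smulRight u) ⊓ U ≤ (range X ⊓ U) ⊔ Submodule.span 𝕜 {u} := by
    rintro _ ⟨⟨x, rfl⟩, hx⟩
    have hx' : X x + v x • u ∈ U := hx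
    have hX : X x ∈ U := (U.add_mem_iff_left (U.smul_mem _ hu)).mp hx'
    exact Submodule.add_mem_sup ⟨⟨x, rfl⟩, hX⟩
      (Submodule.smul_mem _ _ (Submodule.mem_span_singleton_self u))
  refine (Submodule.finrank_mono h).trans
    ((Submodule.finrank_add_le_finrank_add_finrank _ _).trans (Nat.add_le_add_left ?_ _))
  exact (finrank_span_le_card {u}).trans (by simp)

theorem range_add_smulRight_inf_le {U : Submodule 𝕜 P} {X : Q →ₗ[𝕜] P}
    {u : P} (v : Q →ₗ[𝕜] 𝕜) (hu : u ∉ range X ⊔ U) :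
    range (X + v.smulRight u) ⊓ U ≤ range X ⊓ U := by
  rintro _ ⟨⟨x, rfl⟩, hx⟩
  have hx' : X x + v x • u ∈ U := hx
  have hv : v x = 0 := by
    by_contra hv
    refine hu (((range X ⊔ U).smul_mem_iff hv).mp ?_)
    have : v x • u = -X x + (X x + v x • u) := by abel
    rw [this]
    exact Submodule.add_mem_sup (neg_mem ⟨x, rfl⟩) hx'
  refine ⟨⟨x, ?_⟩, hx⟩
  simp [hv]

theorem finrank_ker_sup_le_add_one {K : Submodule 𝕜 Q} {X : Q →ₗ[𝕜] P}
    {v : Q →ₗ[𝕜] 𝕜} {z : Q} (u : P) (hv : v z ≠ 0) (hz : X z = 0) :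
    finrank 𝕜 ↥(ker X ⊔ K) ≤ finrank 𝕜 ↥(ker (X + v.smulRight u) ⊔ K) + 1 := by
  have h : ker X ⊔ K ≤ (ker (X + v.smulRight u) ⊔ K) ⊔ Submodule.span 𝕜 {z} := by
    refine sup_le (fun x hx => ?_) (le_sup_right.trans le_sup_left)
    have hx0 : X x = 0 := hx
    have : x = (x - (v x * (v z)⁻¹) • z) + (v x * (v z)⁻¹) • z := by abel
    rw [this]
    refine Submodule.add_mem_sup (Submodule.mem_sup_left ?_)
      (Submodule.smul_mem _ _ (Submodule.mem_span_singleton_self z))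
    simp [hx0, hz, hv]
  refine (Submodule.finrank_mono h).trans
    ((Submodule.finrank_add_le_finrank_add_finrank _ _).trans (Nat.add_le_add_left ?_ _))
  exact (finrank_span_le_card {z}).trans (by simp)

theorem ker_sup_le_of_mem_inf {K : Submodule 𝕜 Q} {X : Q →ₗ[𝕜] P}
    {v : Q →ₗ[𝕜] 𝕜} {z : Q} (u : P) (hv : v z ≠ 0) (hz : z ∈ ker X ⊓ K) :
    ker X ⊔ K ≤ ker (X + v.smulRight u) ⊔ K := by
  refine sup_le (fun x hx => ?_) le_sup_right
  have hx0 : X x = 0 := hx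
  have hz0 : X z = 0 := hz.1
  have : x = (x - (v x * (v z)⁻¹) • z) + (v x * (v z)⁻¹) • z := by abel
  rw [this]
  refine Submodule.add_mem_sup ?_ (Submodule.smul_mem _ _ hz.2)
  simp [hx0, hz0, hv]

/-- `X` extends `X₀` by a sum of three maps: one with range in `U`, one vanishing on `K`, and one
of rank at most `e`. -/
def IsExtension (U : Submodule 𝕜 P) (K : Submodule 𝕜 Q) (X₀ X : Q →ₗ[𝕜] P) (e : ℕ) : Prop :=
  ∃ E₁ E₂ E₃ : Q →ₗ[𝕜] P, X = X₀ + E₁ + E₂ + E₃ ∧ range E₁ ≤ U ∧ K ≤ ker E₂ ∧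
    finrank 𝕜 (range E₃) ≤ e

variable {U : Submodule 𝕜 P} {K : Submodule 𝕜 Q} {X₀ X : Q →ₗ[𝕜] P} {e : ℕ}

theorem IsExtension.add_range (h : IsExtension U K X₀ X e) (v : Q →ₗ[𝕜] 𝕜) {u : P} (hu : u ∈ U) :
    IsExtension U K X₀ (X + v.smulRight u) e := by
  obtain ⟨E₁, E₂, E₃, rfl, h1, h2, h3⟩ := h
  refine ⟨E₁ + v.smulRight u, E₂, E₃, by abel, ?_, h2, h3⟩
  rintro _ ⟨x, rfl⟩
  exact add_mem (h1 ⟨x, rfl⟩) (U.smul_mem _ hu)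

theorem IsExtension.add_ker (h : IsExtension U K X₀ X e) {v : Q →ₗ[𝕜] 𝕜} (u : P)
    (hv : K ≤ ker v) : IsExtension U K X₀ (X + v.smulRight u) e := by
  obtain ⟨E₁, E₂, E₃, rfl, h1, h2, h3⟩ := h
  refine ⟨E₁, E₂ + v.smulRight u, E₃, by abel, h1, fun x hx => ?_, h3⟩
  have h4 : E₂ x = 0 := h2 hx
  have h5 : v x = 0 := hv hx
  simp [h4, h5]

theorem IsExtension.add_any (h : IsExtension U K X₀ X e) (v : Q →ₗ[𝕜] 𝕜) (u : P) :
    IsExtension U K X₀ (X + v.smulRight u) (e + 1) := by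
  obtain ⟨E₁, E₂, E₃, rfl, h1, h2, h3⟩ := h
  exact ⟨E₁, E₂, E₃ + v.smulRight u, by abel, h1, h2,
    (finrank_range_add_smulRight_le _ _ _).trans (Nat.add_le_add_right h3 1)⟩

theorem exists_notMem_of_ne_top {S : Submodule 𝕜 P} (hS : S ≠ ⊤) : ∃ x, x ∉ S := by
  obtain ⟨x, hx, -⟩ := exists_notMem_notMem hS hS
  exact ⟨x, hx⟩

theorem exists_dual_ker_ge_ne_zero {x : Q} (hx : x ∉ K) :
    ∃ v : Q →ₗ[𝕜] 𝕜, K ≤ ker v ∧ v x ≠ 0 := by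
  obtain ⟨v, hv, hK⟩ := Submodule.exists_le_ker_of_notMem hx
  exact ⟨v, hK, hv⟩

/-- The first alternative bounds dim(range X ∩ U) + codim(ker X + K) + e by l - d: each step raises
at most one of the three terms, by at most one. Free summands (counted by e) are used only once U ≤
range X and ker X ≤ K, where the bound turns into a bound on e. In the second alternative cheap
summands remain available for ever. -/
theorem exists_isExtension_invariant {d : ℕ} (hd : finrank 𝕜 (range X₀) = d)
    (hU : range X₀ ⊓ U = ⊥) (hK : ker X₀ ⊔ K = ⊤) (l : ℕ) (hdl : d ≤ l)
    (hP : l ≤ finrank 𝕜 P) (hQ : l ≤ finrank 𝕜 Q) :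
    ∃ (X : Q →ₗ[𝕜] P) (e : ℕ), finrank 𝕜 (range X) = l ∧ IsExtension U K X₀ X e ∧
      ((finrank 𝕜 ↥(range X ⊓ U) + finrank 𝕜 Q + d + e ≤ l + finrank 𝕜 ↥(ker X ⊔ K) ∧
        (e = 0 ∨ (U ≤ range X ∧ ker X ≤ K))) ∨
      (e = 0 ∧ range X ⊔ U = ⊤ ∧ ker X ⊓ K = ⊥)) := by
  induction l, hdl using Nat.le_induction with
  | base =>
    refine ⟨X₀, 0, hd, ⟨0, 0, 0, by simp, by simp, by simp, by simp⟩,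
      Or.inl ⟨?_, Or.inl rfl⟩⟩
    rw [hU, hK, finrank_bot, finrank_top]
    omega
  | succ l hdl ih =>
    obtain ⟨X, e, hX, hE, h⟩ := ih (by omega) (by omega)
    have hr : range X ≠ ⊤ := exists_notMem_of_finrank_range_lt (by omega)
    obtain ⟨z, hz, hz0⟩ := exists_ker_ne_zero_of_finrank_range_lt (X := X) (by omega)
    obtain ⟨u₀, hu₀⟩ := exists_notMem_of_ne_top hr
    -- Since range X ≠ ⊤ = range X + U, some u in U lies outside range X; the update enlarges the
    -- range and shrinks the kernel, so both conditions persist.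
    have hboth : e = 0 → range X ⊔ U = ⊤ → ker X ⊓ K = ⊥ → ∃ (X : Q →ₗ[𝕜] P) (e : ℕ),
        finrank 𝕜 (range X) = l + 1 ∧ IsExtension U K X₀ X e ∧
        ((finrank 𝕜 ↥(range X ⊓ U) + finrank 𝕜 Q + d + e ≤ l + 1 + finrank 𝕜 ↥(ker X ⊔ K) ∧
          (e = 0 ∨ (U ≤ range X ∧ ker X ≤ K))) ∨
        (e = 0 ∧ range X ⊔ U = ⊤ ∧ ker X ⊓ K = ⊥)) := by
      rintro he hRU hKK
      obtain ⟨u, huU, hu⟩ : ∃ u ∈ U, u ∉ range X := by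
        by_contra! h'
        exact hr (by rwa [sup_eq_left.mpr h'] at hRU)
      obtain ⟨v, hv⟩ := exists_dual_ne_zero (𝕜 := 𝕜) hz0
      refine ⟨X + v.smulRight u, e, by rw [finrank_range_add_smulRight hz hv hu, hX],
        hE.add_range v huU, Or.inr ⟨he, ?_, ?_⟩⟩
      · exact top_le_iff.mp (hRU ▸ sup_le_sup_right (range_le_range_add_smulRight hz hv).1 U)
      · exact le_bot_iff.mp (hKK ▸ inf_le_inf_right K (ker_add_smulRight_le hu))
    rcases h with ⟨hc, he⟩ | ⟨he, hRU, hKK⟩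
    swap
    · exact hboth he hRU hKK
    by_cases hmax : U ≤ range X ∧ ker X ≤ K
    · obtain ⟨v, hv⟩ := exists_dual_ne_zero (𝕜 := 𝕜) hz0
      have hle := (range_le_range_add_smulRight (u := u₀) hz hv).1
      have hker := (ker_add_smulRight_le (v := v) hu₀).trans hmax.2
      refine ⟨X + v.smulRight u₀, e + 1, by rw [finrank_range_add_smulRight hz hv hu₀, hX],
        hE.add_any v u₀, Or.inl ⟨?_, Or.inr ⟨hmax.1.trans hle, hker⟩⟩⟩
      rw [inf_eq_right.mpr (hmax.1.trans hle), sup_eq_right.mpr hker]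
      rw [inf_eq_right.mpr hmax.1, sup_eq_right.mpr hmax.2] at hc
      omega
    have he0 : e = 0 := he.resolve_right hmax
    -- A summand with values in U: taking v nonzero on ker X ∩ K keeps ker X + K from shrinking.
    by_cases h1 : ¬ U ≤ range X ∧ ker X ⊓ K ≠ ⊥
    · obtain ⟨u, huU, hu⟩ := Set.not_subset.mp h1.1
      obtain ⟨w, hw, hw0⟩ := Submodule.exists_mem_ne_zero_of_ne_bot h1.2
      obtain ⟨v, hv⟩ := exists_dual_ne_zero (𝕜 := 𝕜) hw0
      refine ⟨X + v.smulRight u, e, by rw [finrank_range_add_smulRight hw.1 hv hu, hX],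
        hE.add_range v huU, Or.inl ⟨?_, Or.inl he0⟩⟩
      have h2 := finrank_range_add_smulRight_inf_le (X := X) v huU
      have h3 := Submodule.finrank_mono (ker_sup_le_of_mem_inf u hv hw)
      omega
    -- A summand vanishing on K: taking u outside range X + U keeps range X ∩ U from growing.
    by_cases h2 : ¬ ker X ≤ K ∧ range X ⊔ U ≠ ⊤
    · obtain ⟨w, hw, hwK⟩ := Set.not_subset.mp h2.1
      obtain ⟨u, hu⟩ := exists_notMem_of_ne_top h2.2
      obtain ⟨v, hvK, hv⟩ := exists_dual_ker_ge_ne_zero hwK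
      have hu' : u ∉ range X := fun h' => hu (Submodule.mem_sup_left h')
      refine ⟨X + v.smulRight u, e, by rw [finrank_range_add_smulRight hw hv hu', hX],
        hE.add_ker u hvK, Or.inl ⟨?_, Or.inl he0⟩⟩
      have h3 := Submodule.finrank_mono (range_add_smulRight_inf_le (X := X) v hu)
      have h4 := finrank_ker_sup_le_add_one (K := K) u hv hw
      omega
    -- With both cheap moves blocked and X not saturated, the second alternative must hold.
    have h3 : U ≤ range X → range X ⊔ U ≠ ⊤ := fun h' => by rwa [sup_eq_left.mpr h']
    have h4 : ker X ≤ K → ker X ⊓ K ≠ ⊥ := fun h' => by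
      rw [inf_eq_left.mpr h']
      exact (Submodule.ne_bot_iff _).mpr ⟨z, hz, hz0⟩
    refine hboth he0 (by_contra fun hne => ?_) (by_contra fun hne => ?_)
    · have hker : ker X ≤ K := by_contra fun h' => h2 ⟨h', hne⟩
      exact h1 ⟨fun h' => hmax ⟨h', hker⟩, h4 hker⟩
    · have hUX : U ≤ range X := by_contra fun h' => h1 ⟨h', hne⟩
      exact h2 ⟨fun h' => hmax ⟨hUX, h'⟩, h3 hUX⟩

/-- A map `X₀` whose range meets `U` trivially and whose kernel is complementary enough to `K`
extends to a map of any admissible rank, using as few free rank one summands as possible. -/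
theorem exists_isExtension {d : ℕ} (hd : finrank 𝕜 (range X₀) = d)
    (hU : range X₀ ⊓ U = ⊥) (hK : ker X₀ ⊔ K = ⊤) (l : ℕ) (hdl : d ≤ l)
    (hP : l ≤ finrank 𝕜 P) (hQ : l ≤ finrank 𝕜 Q) :
    ∃ (X : Q →ₗ[𝕜] P) (e : ℕ), finrank 𝕜 (range X) = l ∧ IsExtension U K X₀ X e ∧
      (e = 0 ∨ finrank 𝕜 U + finrank 𝕜 Q + d + e ≤ l + finrank 𝕜 K) := by
  obtain ⟨X, e, hX, hE, ⟨hc, he | ⟨h1, h2⟩⟩ | ⟨he, -⟩⟩ :=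
    exists_isExtension_invariant hd hU hK l hdl hP hQ
  · exact ⟨X, e, hX, hE, Or.inl he⟩
  · rw [inf_eq_right.mpr h1, sup_eq_right.mpr h2] at hc
    exact ⟨X, e, hX, hE, Or.inr hc⟩
  · exact ⟨X, e, hX, hE, Or.inl he⟩

end Extension

theorem finrank_map_add_finrank_inf_ker {𝕜 E F : Type*} [Field 𝕜] [AddCommGroup E] [Module 𝕜 E]
    [FiniteDimensional 𝕜 E] [AddCommGroup F] [Module 𝕜 F] (f : E →ₗ[𝕜] F) (S : Submodule 𝕜 E) :
    finrank 𝕜 (S.map f) + finrank 𝕜 ↥(S ⊓ ker f) = finrank 𝕜 S := by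
  have h := finrank_range_add_finrank_ker (f.domRestrict S)
  rw [range_domRestrict, ker_domRestrict] at h
  rw [← h, ← Submodule.map_comap_subtype]
  congr 1
  exact ((Submodule.equivMapOfInjective S.subtype S.injective_subtype _).finrank_eq).symm

/-! ### Lower bounds and the minimum -/

section Triple

variable {𝕜 N M P Q : Type*} [Field 𝕜] [AddCommGroup N] [Module 𝕜 N] [FiniteDimensional 𝕜 N]
  [AddCommGroup M] [Module 𝕜 M] [FiniteDimensional 𝕜 M]
  [AddCommGroup P] [Module 𝕜 P] [FiniteDimensional 𝕜 P]
  [AddCommGroup Q] [Module 𝕜 Q] [FiniteDimensional 𝕜 Q]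
  (A : N →ₗ[𝕜] M) (B : P →ₗ[𝕜] M) (C : N →ₗ[𝕜] Q)

/-- B maps B⁻¹(range A) onto range A ∩ range B with kernel ker B. -/
theorem finrank_comap_range_add :
    finrank 𝕜 ((range A).comap B) + finrank 𝕜 ↥(range A ⊔ range B) =
      finrank 𝕜 P + finrank 𝕜 (range A) := by
  have hker : ker B ≤ (range A).comap B := fun x hx => by
    have hx' : B x = 0 := hx
    simp [hx']
  have h1 := finrank_map_add_finrank_inf_ker B ((range A).comap B)
  rw [Submodule.map_comap_eq, inf_eq_right.mpr hker, inf_comm] at h1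
  have h2 := finrank_range_add_finrank_ker B
  have h3 := Submodule.finrank_sup_add_finrank_inf_eq (range A) (range B)
  omega

theorem finrank_map_ker_add :
    finrank 𝕜 ((ker A).map C) + finrank 𝕜 ↥(ker A ⊓ ker C) + finrank 𝕜 (range A) =
      finrank 𝕜 N := by
  rw [finrank_map_add_finrank_inf_ker, add_comm, finrank_range_add_finrank_ker]

/-- The kernel of the block map with rows `[A, B]` and `[C, 0]`. -/
abbrev blockKer : Submodule 𝕜 (N × P) := ker (A.coprod B) ⊓ ker (C ∘ₗ LinearMap.fst 𝕜 N P)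

theorem finrank_map_ker_coprod_add :
    finrank 𝕜 ((ker (A.coprod B)).map (C ∘ₗ LinearMap.fst 𝕜 N P)) + finrank 𝕜 (blockKer A B C) +
      finrank 𝕜 ↥(range A ⊔ range B) = finrank 𝕜 N + finrank 𝕜 P := by
  rw [finrank_map_add_finrank_inf_ker, ← range_coprod, add_comm, finrank_range_add_finrank_ker,
    finrank_prod]

theorem blockKer_affineMap (X : Q →ₗ[𝕜] P) :
    blockKer (affineMap A B C X) B C = blockKer A B C := by
  ext ⟨y, u⟩
  simp only [Submodule.mem_inf, mem_ker, coprod_apply, comp_apply, fst_apply, LinearMap.add_apply]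
  constructor <;> rintro ⟨h1, h2⟩ <;> simp_all

/-- This is r(G) + r(H) - r(M) ≤ r(A) in terms of kernels; it compares C(ker A) with the larger
space of all C y with A y in range B. Equality of these two spaces gives the converse inequality
below. -/
theorem finrank_sup_add_blockKer_le :
    finrank 𝕜 ↥(range A ⊔ range B) + finrank 𝕜 (blockKer A B C) ≤
      finrank 𝕜 (range A) + finrank 𝕜 P + finrank 𝕜 ↥(ker A ⊓ ker C) := by
  have h1 := finrank_map_ker_add A C
  have h2 := finrank_map_ker_coprod_add A B C
  have h3 : (ker A).map C ≤ (ker (A.coprod B)).map (C ∘ₗ LinearMap.fst 𝕜 N P) := by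
    rintro _ ⟨y, hy, rfl⟩
    have hy' : A y = 0 := hy
    exact ⟨(y, 0), by simp [hy'], rfl⟩
  have h4 := Submodule.finrank_mono h3
  omega

theorem le_finrank_sup_add_blockKer (h : ∀ y u, A y = B u → C y ∈ (ker A).map C) :
    finrank 𝕜 (range A) + finrank 𝕜 P + finrank 𝕜 ↥(ker A ⊓ ker C) ≤
      finrank 𝕜 ↥(range A ⊔ range B) + finrank 𝕜 (blockKer A B C) := by
  have h1 := finrank_map_ker_add A C
  have h2 := finrank_map_ker_coprod_add A B C
  have h3 : (ker (A.coprod B)).map (C ∘ₗ LinearMap.fst 𝕜 N P) ≤ (ker A).map C := by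
    rintro _ ⟨⟨y, u⟩, hy, rfl⟩
    have hy' : A y + B u = 0 := hy
    exact h y (-u) (by rw [map_neg]; exact eq_neg_of_add_eq_zero_left hy')
  have h4 := Submodule.finrank_mono h3
  omega

theorem finrank_sup_add_blockKer_le_affineMap (X : Q →ₗ[𝕜] P) :
    finrank 𝕜 ↥(range A ⊔ range B) + finrank 𝕜 (blockKer A B C) ≤
      finrank 𝕜 (range (affineMap A B C X)) + finrank 𝕜 P + finrank 𝕜 ↥(ker A ⊓ ker C) := by
  have h := finrank_sup_add_blockKer_le (affineMap A B C X) B C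
  rwa [range_affineMap_sup, blockKer_affineMap, ker_affineMap_inf] at h

/-- If T y = 0 then B X C y = -A y, so C(ker T) lies in the preimage under X of B⁻¹(range A), whose
dimension is at most dim B⁻¹(range A) + dim ker X. -/
theorem finrank_range_add_le_affineMap (X : Q →ₗ[𝕜] P) :
    finrank 𝕜 (range X) + finrank 𝕜 (range A) + finrank 𝕜 ((ker A).map C) ≤
      finrank 𝕜 (range (affineMap A B C X)) + finrank 𝕜 ((range A).comap B) + finrank 𝕜 Q := by
  have h1 := finrank_map_ker_add A C
  have h2 := finrank_map_ker_add (affineMap A B C X) C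
  rw [ker_affineMap_inf] at h2
  have h3 : (ker (affineMap A B C X)).map C ≤ ((range A).comap B).comap X := by
    rintro _ ⟨y, hy, rfl⟩
    have hy' : A y + B (X (C y)) = 0 := hy
    exact ⟨-y, by rw [map_neg]; exact neg_eq_of_add_eq_zero_right hy'⟩
  have h4 := Submodule.finrank_mono h3
  have h5 := finrank_map_add_finrank_inf_ker X (((range A).comap B).comap X)
  have h6 := Submodule.finrank_mono (Submodule.map_comap_le X ((range A).comap B))
  have h7 := Submodule.finrank_mono
    (inf_le_right : ((range A).comap B).comap X ⊓ ker X ≤ ker X)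
  have h8 := finrank_range_add_finrank_ker X
  omega

/-- If `C y ∈ C (ker A)` whenever `A y ∈ range B`, then summands of `X` with range in
`B⁻¹ (range A)`, or vanishing on `C (ker A)`, do not raise the rank. -/
theorem finrank_range_affineMap_add_le (h : ∀ y u, A y = B u → C y ∈ (ker A).map C)
    (E₁ E₂ E₃ : Q →ₗ[𝕜] P) (h₁ : range E₁ ≤ (range A).comap B) (h₂ : (ker A).map C ≤ ker E₂) :
    finrank 𝕜 (range (affineMap A B C (E₁ + E₂ + E₃))) ≤
      finrank 𝕜 (range A) + finrank 𝕜 (range E₃) := by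
  obtain ⟨g, hg⟩ := A.rangeRestrict.exists_rightInverse_of_surjective A.range_rangeRestrict
  -- Y lifts B E₁ through A, and the hypothesis gives E₂ C Y = 0. Hence A + B(E₁ + E₂)C factors as
  -- (A + B E₂ C)(1 + Y C), and the left factor vanishes on ker A.
  let Y : Q →ₗ[𝕜] N := g ∘ₗ (B ∘ₗ E₁).codRestrict (range A) fun z => h₁ ⟨z, rfl⟩
  have hY : ∀ z, A (Y z) = B (E₁ z) := fun z =>
    congrArg Subtype.val
      (LinearMap.congr_fun hg ((B ∘ₗ E₁).codRestrict (range A) (fun z => h₁ ⟨z, rfl⟩) z))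
  have hE : ∀ z, E₂ (C (Y z)) = 0 := fun z => h₂ (h _ _ (hY z))
  have heq : affineMap A B C (E₁ + E₂ + E₃) =
      affineMap ((A + B ∘ₗ E₂ ∘ₗ C) ∘ₗ (LinearMap.id + Y ∘ₗ C)) B C E₃ := by
    ext y
    simp [hY, hE]
    abel
  rw [heq]
  refine (finrank_range_affineMap_le_add _ B C E₃).trans (Nat.add_le_add_right ?_ _)
  refine (Submodule.finrank_mono (range_comp_le_range _ _)).trans
    (finrank_range_le_of_ker_le fun y hy => ?_)
  have hE' : E₂ (C y) = 0 := h₂ ⟨y, hy, rfl⟩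
  have hy' : A y = 0 := hy
  simp [hE', hy']

/-- `X` lowers the rank of `A` by its own rank `d`, in a way that can be extended further. -/
structure IsReducing (X : Q →ₗ[𝕜] P) (d : ℕ) : Prop where
  finrank_eq : finrank 𝕜 (range X) = d
  finrank_add : finrank 𝕜 (range (affineMap A B C X)) + d = finrank 𝕜 (range A)
  inf_eq : range X ⊓ (range (affineMap A B C X)).comap B = ⊥
  sup_eq : ker X ⊔ (ker (affineMap A B C X)).map C = ⊤

variable {A B C}

/-- Take y with T y = B u and C y outside C(ker T), and v vanishing on C(ker T) with v(C y) = -1.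
The update by u and v keeps ker T in the kernel and adds y, while its range stays in range T. The
two transversality conditions supply u outside range X and a vector of ker X on which v is nonzero,
so that r(X) grows. -/
theorem IsReducing.exists_succ {X : Q →ₗ[𝕜] P} {d : ℕ} (hX : IsReducing A B C X d)
    (h : ¬ ∀ y u, affineMap A B C X y = B u → C y ∈ (ker (affineMap A B C X)).map C) :
    ∃ X' : Q →ₗ[𝕜] P, IsReducing A B C X' (d + 1) := by
  push Not at h
  obtain ⟨y, u, hyu, hy⟩ := h
  obtain ⟨w, hwK, hw⟩ := exists_dual_ker_ge_ne_zero hy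
  obtain ⟨v, hvK, hv⟩ : ∃ v : Q →ₗ[𝕜] 𝕜,
      (ker (affineMap A B C X)).map C ≤ ker v ∧ v (C y) = -1 := by
    refine ⟨(-(w (C y))⁻¹) • w, fun x hx => ?_, by simp [hw]⟩
    have : w x = 0 := hwK hx
    simp [this]
  obtain ⟨hX1, hX2, hX3, hX4⟩ := hX
  set T := affineMap A B C X with hT
  have hu0 : u ≠ 0 := by
    rintro rfl
    exact hy ⟨y, by simpa using hyu, rfl⟩
  have hu : u ∉ range X := fun h' => hu0 <| by
    have : u ∈ range X ⊓ (range T).comap B := ⟨h', ⟨y, hyu⟩⟩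
    rwa [hX3, Submodule.mem_bot] at this
  obtain ⟨z₀, hz₀, k₀, hk₀, hzk⟩ := Submodule.mem_sup.mp (hX4 ▸ Submodule.mem_top :
    C y ∈ ker X ⊔ (ker T).map C)
  have hXz₀ : X z₀ = 0 := hz₀
  have hvz₀ : v z₀ = -1 := by
    have hvk : v k₀ = 0 := hvK hk₀
    rw [← hzk, map_add, hvk, add_zero] at hv
    exact hv
  have hvz₀' : v z₀ ≠ 0 := by simp [hvz₀]
  have hrange : range (T + (v ∘ₗ C).smulRight (B u)) ≤ range T :=
    range_add_smulRight_le ⟨y, hyu⟩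
  have hker : ker T ≤ ker (T + (v ∘ₗ C).smulRight (B u)) := by
    intro x hx
    have h1 : T x = 0 := hx
    have h2 : v (C x) = 0 := hvK ⟨x, hx, rfl⟩
    simp [h1, h2]
  have hyker : y ∈ ker (T + (v ∘ₗ C).smulRight (B u)) := by
    simp [hyu, hv]
  have hlt : finrank 𝕜 (range (T + (v ∘ₗ C).smulRight (B u))) < finrank 𝕜 (range T) :=
    finrank_range_lt_of_ker_lt (lt_of_le_of_ne hker fun h' => hy ⟨y, h' ▸ hyker, rfl⟩)
  have hle := finrank_range_le_add_smulRight T (v ∘ₗ C) (B u)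
  -- Otherwise range T would lie in the new range, against the rank drop.
  have hBu : B u ∉ range (T + (v ∘ₗ C).smulRight (B u)) := by
    intro h'
    refine hlt.not_ge (Submodule.finrank_mono ?_)
    rintro _ ⟨x, rfl⟩
    have : T x = (T + (v ∘ₗ C).smulRight (B u)) x - v (C x) • B u := by simp
    rw [this]
    exact sub_mem ⟨x, rfl⟩ (Submodule.smul_mem _ _ h')
  have hA : affineMap A B C (X + v.smulRight u) = T + (v ∘ₗ C).smulRight (B u) :=
    affineMap_add_smulRight A B C X v u
  refine ⟨X + v.smulRight u, ⟨?_, ?_, ?_, ?_⟩⟩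
  · rw [finrank_range_add_smulRight hXz₀ hvz₀' hu, hX1]
  · rw [hA]
    omega
  · rw [hA, eq_bot_iff]
    rintro _ ⟨⟨x, rfl⟩, hx⟩
    have hx' : B (X x + v x • u) ∈ range (T + (v ∘ₗ C).smulRight (B u)) := hx
    have hXx : B (X x) ∈ range T := by
      have : B (X x) = B (X x + v x • u) - v x • B u := by simp
      rw [this]
      exact sub_mem (hrange hx') (Submodule.smul_mem _ _ ⟨y, hyu⟩)
    have hX0 : X x = 0 := by
      have : X x ∈ range X ⊓ (range T).comap B := ⟨⟨x, rfl⟩, hXx⟩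
      rwa [hX3, Submodule.mem_bot] at this
    rw [hX0, zero_add, map_smul] at hx'
    have hvx : v x = 0 := by
      by_contra hvx
      exact hBu ((Submodule.smul_mem_iff _ hvx).mp hx')
    simp [hX0, hvx]
  · rw [hA, eq_top_iff]
    intro x _
    obtain ⟨z, hz, k, hk, rfl⟩ := Submodule.mem_sup.mp (hX4 ▸ Submodule.mem_top :
      x ∈ ker X ⊔ (ker T).map C)
    have hXz : X z = 0 := hz
    have hmono := Submodule.map_mono (f := C) hker
    -- Here z₀ = C y - k₀ lies in the enlarged C(ker), and v z₀ = -1 makes the first summand vanish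
    -- under the updated X.
    have : z + k = (z + v z • z₀) + (k - v z • (C y - k₀)) := by
      rw [← hzk, add_sub_cancel_right]
      abel
    rw [this]
    refine Submodule.add_mem_sup ?_ (sub_mem (hmono hk)
      (Submodule.smul_mem _ _ (sub_mem ⟨y, hyker, rfl⟩ (hmono hk₀))))
    simp [hXz, hXz₀, hvz₀]

variable (A B C)

theorem exists_isReducing (l : ℕ) :
    (∃ X : Q →ₗ[𝕜] P, IsReducing A B C X l) ∨
      ∃ (X : Q →ₗ[𝕜] P) (d : ℕ), d ≤ l ∧ IsReducing A B C X d ∧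
        ∀ y u, affineMap A B C X y = B u → C y ∈ (ker (affineMap A B C X)).map C := by
  induction l with
  | zero =>
    exact Or.inl ⟨0, ⟨by simp, by rw [affineMap_zero, add_zero], by simp, by simp⟩⟩
  | succ l ih =>
    rcases ih with ⟨X, hX⟩ | ⟨X, d, hd, hX, h⟩
    · by_cases h : ∀ y u, affineMap A B C X y = B u → C y ∈ (ker (affineMap A B C X)).map C
      · exact Or.inr ⟨X, l, by omega, hX, h⟩
      · exact Or.inl (hX.exists_succ h)
    · exact Or.inr ⟨X, d, by omega, hX, h⟩

/-- A map of any admissible rank `l` for which the rank of `A + B X C` attains one of its three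
lower bounds. -/
theorem exists_finrank_range_affineMap_min (l : ℕ) (hP : l ≤ finrank 𝕜 P)
    (hQ : l ≤ finrank 𝕜 Q) :
    ∃ X : Q →ₗ[𝕜] P, finrank 𝕜 (range X) = l ∧
      (finrank 𝕜 (range (affineMap A B C X)) + l ≤ finrank 𝕜 (range A) ∨
      finrank 𝕜 (range (affineMap A B C X)) + finrank 𝕜 P + finrank 𝕜 ↥(ker A ⊓ ker C) ≤
        finrank 𝕜 ↥(range A ⊔ range B) + finrank 𝕜 (blockKer A B C) ∨
      finrank 𝕜 (range (affineMap A B C X)) + finrank 𝕜 ((range A).comap B) + finrank 𝕜 Q ≤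
        l + finrank 𝕜 (range A) + finrank 𝕜 ((ker A).map C)) := by
  rcases exists_isReducing A B C l with ⟨X, hX⟩ | ⟨X, d, hd, hX, h⟩
  · exact ⟨X, hX.finrank_eq, Or.inl hX.finrank_add.le⟩
  obtain ⟨Y, e, hY, ⟨E₁, E₂, E₃, rfl, h1, h2, h3⟩, he⟩ :=
    exists_isExtension hX.finrank_eq hX.inf_eq hX.sup_eq l hd hP hQ
  refine ⟨_, hY, Or.inr ?_⟩
  have heq : affineMap A B C (X + E₁ + E₂ + E₃) =
      affineMap (affineMap A B C X) B C (E₁ + E₂ + E₃) := by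
    ext y; simp; abel
  have h4 := finrank_range_affineMap_add_le _ B C h E₁ E₂ E₃ h1 h2
  rw [← heq] at h4
  have h5 := le_finrank_sup_add_blockKer _ B C h
  rw [range_affineMap_sup, blockKer_affineMap, ker_affineMap_inf] at h5
  -- Passing from A to the reduced map lowers dim B⁻¹(range) by d and raises dim C(ker) by d. So e =
  -- 0 gives the bound with r(M), and the other case of `he` gives the bound with l - p - q.
  have h6 := finrank_comap_range_add A B
  have h7 := finrank_comap_range_add (affineMap A B C X) B
  rw [range_affineMap_sup] at h7
  have h8 := finrank_map_ker_add A C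
  have h9 := finrank_map_ker_add (affineMap A B C X) C
  rw [ker_affineMap_inf] at h9
  have h10 := hX.finrank_add
  generalize finrank 𝕜 (range (affineMap A B C (X + E₁ + E₂ + E₃))) = r at *
  omega

end Triple

/-! ### Translation to matrix ranks -/

section Matrix

variable {m n p q : ℕ} (A : Matrix (Fin m) (Fin n) ℂ) (B : Matrix (Fin m) (Fin p) ℂ)
    (C : Matrix (Fin q) (Fin n) ℂ)

theorem rank_linearMatrixFun (X : Matrix (Fin p) (Fin q) ℂ) :
    (linearMatrixFun A B C X).rank =
      finrank ℂ (range (affineMap A.mulVecLin B.mulVecLin C.mulVecLin X.mulVecLin)) := by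
  rw [Matrix.rank, linearMatrixFun, Matrix.mulVecLin_add, Matrix.mulVecLin_mul,
    Matrix.mulVecLin_mul, LinearMap.comp_assoc]

theorem rank_fromCols :
    (Matrix.fromCols A B).rank = finrank ℂ ↥(range A.mulVecLin ⊔ range B.mulVecLin) := by
  have h : range (Matrix.fromCols A B).mulVecLin = range A.mulVecLin ⊔ range B.mulVecLin := by
    apply le_antisymm
    · rintro _ ⟨x, rfl⟩
      rw [Matrix.mulVecLin_apply, Matrix.fromCols_mulVec]
      exact Submodule.add_mem_sup ⟨_, rfl⟩ ⟨_, rfl⟩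
    · refine sup_le ?_ ?_
      · rintro _ ⟨x, rfl⟩
        exact ⟨Sum.elim x 0, by simp [Matrix.fromCols_mulVec]⟩
      · rintro _ ⟨x, rfl⟩
        exact ⟨Sum.elim 0 x, by simp [Matrix.fromCols_mulVec]⟩
  rw [Matrix.rank, h]

theorem rank_fromRows_add :
    (Matrix.fromRows A C).rank + finrank ℂ ↥(ker A.mulVecLin ⊓ ker C.mulVecLin) = n := by
  have h : ker (Matrix.fromRows A C).mulVecLin = ker A.mulVecLin ⊓ ker C.mulVecLin := by
    ext x
    rw [Submodule.mem_inf, mem_ker, mem_ker, mem_ker, Matrix.mulVecLin_apply,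
      Matrix.fromRows_mulVec, ← Sum.elim_zero_zero, Sum.elim_eq_iff]
    rfl
  rw [Matrix.rank, ← h, finrank_range_add_finrank_ker, finrank_fin_fun]

theorem rank_fromBlocks_add :
    (Matrix.fromBlocks A B C 0).rank +
      finrank ℂ (blockKer A.mulVecLin B.mulVecLin C.mulVecLin) = n + p := by
  let e := LinearEquiv.sumArrowLequivProdArrow (Fin n) (Fin p) ℂ ℂ
  have h : ker (Matrix.fromBlocks A B C 0).mulVecLin =
      (blockKer A.mulVecLin B.mulVecLin C.mulVecLin).comap e.toLinearMap := by
    ext x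
    rw [mem_ker, Matrix.mulVecLin_apply, Matrix.fromBlocks_mulVec, ← Sum.elim_zero_zero,
      Sum.elim_eq_iff, Matrix.zero_mulVec, add_zero]
    rfl
  have h1 := finrank_range_add_finrank_ker (Matrix.fromBlocks A B C 0).mulVecLin
  have h2 := LinearEquiv.finrank_map_eq e.symm (blockKer A.mulVecLin B.mulVecLin C.mulVecLin)
  rw [Submodule.map_equiv_eq_comap_symm, e.symm_symm] at h2
  rw [h, h2] at h1
  simpa [Matrix.rank] using h1

theorem uRank_rank_le (X : Matrix (Fin p) (Fin q) ℂ) :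
    uRank A B C X.rank ≤ ((linearMatrixFun A B C X).rank : ℤ) := by
  have h1 := finrank_sup_add_blockKer_le_affineMap A.mulVecLin B.mulVecLin C.mulVecLin X.mulVecLin
  have h2 := finrank_range_add_le_affineMap A.mulVecLin B.mulVecLin C.mulVecLin X.mulVecLin
  have h3 := finrank_range_le_affineMap_add A.mulVecLin B.mulVecLin C.mulVecLin X.mulVecLin
  have h4 := finrank_comap_range_add A.mulVecLin B.mulVecLin
  have h5 := finrank_map_ker_add A.mulVecLin C.mulVecLin
  have h6 := rank_fromRows_add A C
  have h7 := rank_fromBlocks_add A B C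
  rw [← rank_linearMatrixFun, ← rank_fromCols, finrank_fin_fun] at h1
  rw [← rank_linearMatrixFun, finrank_fin_fun, ← Matrix.rank, ← Matrix.rank] at h2
  rw [← rank_linearMatrixFun, ← Matrix.rank, ← Matrix.rank] at h3
  rw [← rank_fromCols, finrank_fin_fun, ← Matrix.rank] at h4
  rw [finrank_fin_fun, ← Matrix.rank] at h5
  refine max_le ?_ (max_le ?_ ?_) <;> omega

theorem exists_rank_linearMatrixFun_le_uRank (l : ℕ) (hp : l ≤ p) (hq : l ≤ q) :
    ∃ X : Matrix (Fin p) (Fin q) ℂ, X.rank = l ∧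
      ((linearMatrixFun A B C X).rank : ℤ) ≤ uRank A B C l := by
  obtain ⟨f, hf, h⟩ := exists_finrank_range_affineMap_min A.mulVecLin B.mulVecLin C.mulVecLin l
    (by rwa [finrank_fin_fun]) (by rwa [finrank_fin_fun])
  obtain ⟨X, rfl⟩ : ∃ X : Matrix (Fin p) (Fin q) ℂ, X.mulVecLin = f :=
    ⟨LinearMap.toMatrix' f, Matrix.toLin'_toMatrix' f⟩
  refine ⟨X, hf, ?_⟩
  have h4 := finrank_comap_range_add A.mulVecLin B.mulVecLin
  have h5 := finrank_map_ker_add A.mulVecLin C.mulVecLin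
  have h6 := rank_fromRows_add A C
  have h7 := rank_fromBlocks_add A B C
  rw [← rank_linearMatrixFun, ← rank_fromCols, finrank_fin_fun, finrank_fin_fun,
    ← Matrix.rank] at h
  rw [← rank_fromCols, finrank_fin_fun, ← Matrix.rank] at h4
  rw [finrank_fin_fun, ← Matrix.rank] at h5
  rw [uRank, le_max_iff, le_max_iff]
  omega

theorem rank_linearMatrixFun_le_min (X : Matrix (Fin p) (Fin q) ℂ) :
    (linearMatrixFun A B C X).rank ≤
      min (Matrix.fromCols A B).rank (min (Matrix.fromRows A C).rank (A.rank + X.rank)) := by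
  have h1 := finrank_range_affineMap_le_sup A.mulVecLin B.mulVecLin C.mulVecLin X.mulVecLin
  have h2 := finrank_range_affineMap_add_ker_inf_le A.mulVecLin B.mulVecLin C.mulVecLin X.mulVecLin
  have h3 := finrank_range_affineMap_le_add A.mulVecLin B.mulVecLin C.mulVecLin X.mulVecLin
  have h6 := rank_fromRows_add A C
  rw [← rank_linearMatrixFun, ← rank_fromCols] at h1
  rw [← rank_linearMatrixFun, finrank_fin_fun] at h2
  rw [← rank_linearMatrixFun, ← Matrix.rank, ← Matrix.rank] at h3
  refine le_min ?_ (le_min ?_ ?_) <;> omega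

theorem exists_min_le_rank_linearMatrixFun (l : ℕ) (hp : l ≤ p) (hq : l ≤ q) :
    ∃ X : Matrix (Fin p) (Fin q) ℂ, X.rank = l ∧
      min (Matrix.fromCols A B).rank (min (Matrix.fromRows A C).rank (A.rank + l)) ≤
        (linearMatrixFun A B C X).rank := by
  obtain ⟨f, hf, h⟩ := exists_finrank_range_affineMap_max A.mulVecLin B.mulVecLin C.mulVecLin l
    (by rwa [finrank_fin_fun]) (by rwa [finrank_fin_fun])
  obtain ⟨X, rfl⟩ : ∃ X : Matrix (Fin p) (Fin q) ℂ, X.mulVecLin = f :=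
    ⟨LinearMap.toMatrix' f, Matrix.toLin'_toMatrix' f⟩
  refine ⟨X, hf, ?_⟩
  have h6 := rank_fromRows_add A C
  rw [← rank_linearMatrixFun, ← rank_fromCols, finrank_fin_fun, ← Matrix.rank] at h
  rw [min_le_iff, min_le_iff]
  omega

end Matrix

end RankUpdate

theorem corollary3p3 {m n p q : ℕ} (A : Matrix (Fin m) (Fin n) ℂ) (B : Matrix (Fin m) (Fin p) ℂ)
    (C : Matrix (Fin q) (Fin n) ℂ) (s t : ℕ) (hst : s ≤ t) (ht : t ≤ min p q) :
    IsGreatest (feasibleRanks A B C s t)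
      (min ((Matrix.fromCols A B).rank : ℤ)
        (min ((Matrix.fromRows A C).rank : ℤ) ((A.rank : ℤ) + (t : ℤ)))) ∧
    IsLeast (feasibleRanks A B C s t)
      ((Finset.Icc s t).inf' (Finset.nonempty_Icc.mpr hst) (fun l => uRank A B C l)) := by
  have htp : t ≤ p := ht.trans (min_le_left p q)
  have htq : t ≤ q := ht.trans (min_le_right p q)
  refine ⟨⟨?_, ?_⟩, ⟨?_, ?_⟩⟩
  -- The upper bound is monotone in r(X), so the largest rank t already attains the maximum.
  · obtain ⟨X, hX, h⟩ := RankUpdate.exists_min_le_rank_linearMatrixFun A B C t htp htq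
    have h' := RankUpdate.rank_linearMatrixFun_le_min A B C X
    rw [hX] at h'
    refine ⟨X, by omega, by omega, ?_⟩
    exact_mod_cast le_antisymm h h'
  · rintro _ ⟨X, -, hX, rfl⟩
    have h := RankUpdate.rank_linearMatrixFun_le_min A B C X
    have h' : (linearMatrixFun A B C X).rank ≤
        min (Matrix.fromCols A B).rank (min (Matrix.fromRows A C).rank (A.rank + t)) :=
      h.trans (min_le_min_left _ (min_le_min_left _ (Nat.add_le_add_left hX _)))
    exact_mod_cast h'
  -- Each u_l is the exact minimum over r(X) = l, so a minimizing l yields the witness.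
  · obtain ⟨l, hl, heq⟩ := Finset.exists_mem_eq_inf' (Finset.nonempty_Icc.mpr hst)
      (fun l => uRank A B C l)
    obtain ⟨hsl, hlt⟩ := Finset.mem_Icc.mp hl
    obtain ⟨X, rfl, h⟩ := RankUpdate.exists_rank_linearMatrixFun_le_uRank A B C l
      (hlt.trans htp) (hlt.trans htq)
    exact ⟨X, hsl, hlt, heq.trans (le_antisymm (RankUpdate.uRank_rank_le A B C X) h)⟩
  · rintro _ ⟨X, hsX, hXt, rfl⟩
    exact (Finset.inf'_le _ (Finset.mem_Icc.mpr ⟨hsX, hXt⟩)).trans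
      (RankUpdate.uRank_rank_le A B C X)
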